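/- For $n\ge 0$ let $G_n$ be the ladder graph with vertex set $\{0,1,\dots,n\}\times\{0,1\}$ whose edges join $(i,0)$ to $(i+1,0)$ and $(i,1)$ to $(i+1,1)$ for $0\le i<n$, and $(i,0)$ to $(i,1)$ for $0\le i\le n$; thus $G_n$ is a subgraph of $G_{n+1}$. Let the edges of $\bigcup_n G_n$ carry independent exponentially distributed random weights with parameter $1$, and let $l_n$ be the first-passage time from $(0,0)$ to $(n,0)$ in $G_n$, that is, the infimum over all paths in $G_n$ from $(0,0)$ to $(n,0)$ of the sum of the weights of the edges of the path. Then the percolation rate (time constant) $\chi=\lim_{n\to\infty} l_n/n$ exists almost surely and is almost surely equal to the constant $$\chi=\frac32-\frac{J_1(2)}{2J_2(2)}=0.68\dots,$$ where $J_m(x)=\sum_{k\ge 0}\frac{(-1)^k}{k!\,(k+m)!}\left(\frac x2\right)^{2k+m}$ is the Bessel function of the first kind of order $m$, and $0.68\dots$ means that the value lies in $[0.68,0.69)$. -/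

import Mathlib

open MeasureTheory ProbabilityTheory Filter Topology
open scoped Nat

/-- The weight of a walk `p`: the sum of `w e` over the set of edges that `p` uses. -/
def walkWeight {V : Type*} [DecidableEq V] {G : SimpleGraph V} (w : Sym2 V → ℝ) {u v : V}
    (p : G.Walk u v) : ℝ :=
  ∑ e ∈ p.edges.toFinset, w e

/-- The first-passage time between `u` and `v` in the graph `G` with edge weights `w`: the infimum
of the weights of all walks in `G` from `u` to `v`. -/
noncomputable def firstPassageTime {V : Type*} [DecidableEq V] (G : SimpleGraph V)
    (w : Sym2 V → ℝ) (u v : V) : ℝ :=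
  ⨅ p : G.Walk u v, walkWeight w p

/-- The five translation-invariant classes of edges of a width-two stretch. -/
inductive EdgeClass
  | V | W | X | Y | Z

/-- The edges of each class in the stretch with columns `0, …, n`. -/
def EdgeClass.edges : EdgeClass → ℕ → Set (Sym2 (ℕ × Fin 2))
  | .V, n => {e | ∃ i, i < n ∧ e = s((i, 0), (i + 1, 1))}
  | .W, n => {e | ∃ i, i < n ∧ e = s((i, 1), (i + 1, 0))}
  | .X, n => {e | ∃ i, i < n ∧ e = s((i, 0), (i + 1, 0))}
  | .Y, n => {e | ∃ i, i < n ∧ e = s((i, 1), (i + 1, 1))}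
  | .Z, n => {e | ∃ i, i ≤ n ∧ e = s((i, 0), (i, 1))}

/-- The width-two stretch `G_n^E`. Its vertices are the points of `{0, …, n} × {0, 1}`; the
remaining points of `ℕ × {0, 1}` are isolated, so no walk between vertices of the stretch meets
them. -/
def stretch (E : Set EdgeClass) (n : ℕ) : SimpleGraph (ℕ × Fin 2) :=
  SimpleGraph.fromEdgeSet (⋃ L ∈ E, L.edges n)

/-- The edges of all the graphs `G_n^E`, `n ∈ ℕ`. -/
def stretchEdges (E : Set EdgeClass) : Set (Sym2 (ℕ × Fin 2)) :=
  ⋃ n, (stretch E n).edgeSet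

/-- `χ` is the percolation rate (time constant) of the family `(G_n^E)_n` with respect to the
random edge weights `w`: writing `l_n` for the first-passage time from `(0, 0)` to `(n, 0)` in
`G_n^E`, almost surely `l_n / n` converges to `χ`. -/
def IsPercolationRate {Ω : Type*} [MeasurableSpace Ω] (P : Measure Ω) (E : Set EdgeClass)
    (w : Sym2 (ℕ × Fin 2) → Ω → ℝ) (χ : ℝ) : Prop :=
  ∀ᵐ ω ∂P, Tendsto
    (fun n : ℕ => firstPassageTime (stretch E n) (fun e => w e ω) (0, 0) (n, 0) / (n : ℝ))
    atTop (𝓝 χ)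

/-- The Bessel function of the first kind `J_m`, of order `m ∈ ℕ`, on the real line. -/
noncomputable def besselJ (m : ℕ) (x : ℝ) : ℝ :=
  ∑' k : ℕ, (-1 : ℝ) ^ k / ((k ! : ℝ) * ((k + m)! : ℝ)) * (x / 2) ^ (2 * k + m)

/-- The series that defines `besselJ m x` converges absolutely. -/
theorem summable_besselJ (m : ℕ) (x : ℝ) :
    Summable fun k : ℕ =>
      (-1 : ℝ) ^ k / ((k ! : ℝ) * ((k + m)! : ℝ)) * (x / 2) ^ (2 * k + m) := by
  refine Summable.of_norm_bounded
    (g := fun k : ℕ => |x / 2| ^ m * (((x / 2) ^ 2) ^ k / (k ! : ℝ)))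
    ((Real.summable_pow_div_factorial _).mul_left _) fun k => ?_
  have h1 : (1 : ℝ) ≤ ((k + m)! : ℝ) := by exact_mod_cast Nat.one_le_iff_ne_zero.2 (Nat.factorial_ne_zero _)
  have h2 : (0 : ℝ) < (k ! : ℝ) := by positivity
  rw [norm_mul, norm_div, norm_pow, norm_neg, norm_one, one_pow, norm_mul, norm_pow,
    Real.norm_of_nonneg h2.le, Real.norm_of_nonneg (zero_le_one.trans h1), Real.norm_eq_abs,
    pow_add, pow_mul, sq_abs]
  have h3 : 1 / ((k ! : ℝ) * ((k + m)! : ℝ)) ≤ 1 / (k ! : ℝ) :=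
    one_div_le_one_div_of_le h2 (le_mul_of_one_le_right h2.le h1)
  calc _ ≤ 1 / (k ! : ℝ) * (((x / 2) ^ 2) ^ k * |x / 2| ^ m) := by gcongr
    _ = _ := by ring

/-!
The passage times `a`, `b` from `(0, 0)` to the two vertices of column `n`, computed in the ladder
that ends with this column, obey a recursion (`ladderStep`, `firstPassageTime_ladder`): with `x`, `y`
the weights of the next horizontal edges and `z` that of the next rung,
`a' = min (a + x) (b + y + z)` and `b' = min (b + y) (a + x + z)`. A walk gains nothing by turning
back; this is proved with a potential that is Lipschitz along the edges.

So `b - a` is a Markov chain that drives the increments of `min a b`. Its Poisson equation has the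
explicit solution `ladderCorrector`: for `h = ladderCorrector` and every `(a, b)`,
`E[min a' b' + h (b' - a')] = min a b + h (b - a) + ladderRate` (`integral_ladderIncrement`).
Averaging over the weights and differentiating turns this, for `d = |b - a|` and `g = h'`, into
`g'' = (1 - exp (-d)) g` with boundary values `g 0 = 1 / 2` and `g' 0 = ladderRate - 1`. The
bounded solution is `g d = J₂ (2 exp (-d / 2)) / (2 J₂ 2)`, so that
`ladderRate - 1 = -J₂' 2 / (2 J₂ 2) = 1 / 2 - J₁ 2 / (2 J₂ 2)`. Here `h` is entered as a power
series in `exp (-d)`, without constant term, and the equation is checked term by term: the expected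
value of `exp (-k |b' - a'|)` is a combination of `1`, `exp (-d)` and `exp (-(k + 1) d)`, and the
coefficients match by the recurrence `J₀ + J₂ = J₁` at `2`.

Hence `min a b + h (b - a) - n * ladderRate` has orthogonal increments with bounded second moments
(`integral_sq_ladderMartingale_succ_le`), and divided by `n` it tends to `0` almost surely along the
squares. As `h` is bounded, `min a b` is monotone in `n`, and `a` exceeds `min a b` by at most the
last rung, whose weight is `o(n)`, the passage times themselves satisfy `a / n → ladderRate`. The
numerical value follows from the alternating series of `J₁ 2` and `J₂ 2`.
-/

/-! ### Passage times along the ladder -/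

/-- The effect on a pair `(a, b)` of passage times to the two vertices of a column of appending to
the ladder a column whose new edges have the weights `u = (x, y, z)`: `x` and `y` on the two
horizontal edges, `z` on the rung. -/
noncomputable def ladderStep (t : ℝ × ℝ) (u : ℝ × ℝ × ℝ) : ℝ × ℝ :=
  (min (t.1 + u.1) (t.2 + u.2.1 + u.2.2), min (t.2 + u.2.1) (t.1 + u.1 + u.2.2))

/-- The passage times from `(0, 0)` to the two vertices of column `n` of the ladder with columns
`0, …, n`, as functions of the weights `X`, `Y` of the horizontal edges in the two rows and `Z` of
the rungs. -/
noncomputable def ladderTimes (X Y Z : ℕ → ℝ) : ℕ → ℝ × ℝ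
  | 0 => (0, Z 0)
  | n + 1 => ladderStep (ladderTimes X Y Z n) (X n, Y n, Z (n + 1))

theorem abs_ladderStep_sub {t : ℝ × ℝ} {u : ℝ × ℝ × ℝ} (hz : 0 ≤ u.2.2) :
    |(ladderStep t u).2 - (ladderStep t u).1| = min u.2.2 |t.2 - t.1 + u.2.1 - u.1| := by
  obtain ⟨a, b⟩ := t
  obtain ⟨x, y, z⟩ := u
  simp only [ladderStep] at *
  grind

theorem min_ladderStep {t : ℝ × ℝ} {u : ℝ × ℝ × ℝ} :
    min (ladderStep t u).1 (ladderStep t u).2 =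
      min (t.1 + u.1) (t.2 + u.2.1) + min 0 u.2.2 := by
  obtain ⟨a, b⟩ := t
  obtain ⟨x, y, z⟩ := u
  simp only [ladderStep] at *
  grind

theorem abs_ladderTimes_sub_le {X Y Z : ℕ → ℝ} (hZ : ∀ n, 0 ≤ Z n) (n : ℕ) :
    |(ladderTimes X Y Z n).2 - (ladderTimes X Y Z n).1| ≤ Z n := by
  cases n with
  | zero => simp [ladderTimes, abs_of_nonneg (hZ 0)]
  | succ n => exact (abs_ladderStep_sub (hZ (n + 1))).trans_le (min_le_left _ _)

/-- A potential on the ladder with columns `0, …, n`, with values `f i` and `g i` in column `i`,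
that varies along each edge by at most the weight of the edge, and vanishes at `(0, 0)`. -/
structure IsLadderPotential (X Y Z : ℕ → ℝ) (n : ℕ) (f g : ℕ → ℝ) : Prop where
  zero : f 0 = 0
  row₀ : ∀ i < n, |f (i + 1) - f i| ≤ X i
  row₁ : ∀ i < n, |g (i + 1) - g i| ≤ Y i
  rung : ∀ i ≤ n, |g i - f i| ≤ Z i

/-- The values of the potential in the last column are the passage times on the ladder in which the
two vertices of that column are also joined by a detour of length `r`; the generality in `r` is
what makes the induction on `n` go through, since appending a column adds such a detour to the
shorter ladder. -/
theorem exists_isLadderPotential {X Y Z : ℕ → ℝ} (hX : ∀ n, 0 ≤ X n) (hY : ∀ n, 0 ≤ Y n)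
    (hZ : ∀ n, 0 ≤ Z n) (n : ℕ) (r : ℝ) (hr : 0 ≤ r) :
    ∃ f g, IsLadderPotential X Y Z n f g ∧
      f n = min (ladderTimes X Y Z n).1 ((ladderTimes X Y Z n).2 + r) ∧
      g n = min (ladderTimes X Y Z n).2 ((ladderTimes X Y Z n).1 + r) := by
  induction n generalizing r with
  | zero =>
    refine ⟨fun _ => 0, fun _ => min (Z 0) r, ⟨rfl, by simp, by simp, ?_⟩, ?_, ?_⟩
    · intro i hi
      obtain rfl : i = 0 := by omega
      have := hZ 0
      grind
    · have := hZ 0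
      simp only [ladderTimes]
      grind
    · simp [ladderTimes]
  | succ n ih =>
    obtain ⟨f, g, h, hf, hg⟩ := ih (X n + Y n + min (Z (n + 1)) r)
      (add_nonneg (add_nonneg (hX n) (hY n)) (le_min (hZ _) hr))
    have hab := abs_ladderTimes_sub_le (X := X) (Y := Y) hZ (n + 1)
    have hx := hX n
    have hy := hY n
    have hz := hZ (n + 1)
    set a' := (ladderTimes X Y Z (n + 1)).1 with ha'
    set b' := (ladderTimes X Y Z (n + 1)).2 with hb'
    refine ⟨fun i => if i ≤ n then f i else min a' (b' + r),
      fun i => if i ≤ n then g i else min b' (a' + r), ⟨by simp [h.zero], ?_, ?_, ?_⟩,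
      by simp, by simp⟩
    · intro i hi
      rcases Nat.lt_succ_iff_lt_or_eq.1 hi with hi | rfl
      · simpa [hi.le, Nat.succ_le_of_lt hi] using h.row₀ i hi
      · simp only [ladderTimes, ladderStep] at ha' hb'
        simp only [le_refl, if_true, Nat.not_succ_le_self, if_false, hf]
        clear hf hg hab h ih
        clear_value a' b'
        subst ha' hb'
        rw [abs_le]
        constructor <;> grind
    · intro i hi
      rcases Nat.lt_succ_iff_lt_or_eq.1 hi with hi | rfl
      · simpa [hi.le, Nat.succ_le_of_lt hi] using h.row₁ i hi
      · simp only [ladderTimes, ladderStep] at ha' hb'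
        simp only [le_refl, if_true, Nat.not_succ_le_self, if_false, hg]
        clear hf hg hab h ih
        clear_value a' b'
        subst ha' hb'
        rw [abs_le]
        constructor <;> grind
    · intro i hi
      rcases Nat.le_succ_iff.1 hi with hi | rfl
      · simpa [hi] using h.rung i hi
      · simp only [Nat.not_succ_le_self, if_false]
        clear hf hg ha' hb' h ih
        clear_value a' b'
        grind

section Walks

variable {V : Type*} [DecidableEq V] {G : SimpleGraph V} {w : Sym2 V → ℝ}

theorem walkWeight_nonneg (hw : ∀ e ∈ G.edgeSet, 0 ≤ w e) {u v : V} (p : G.Walk u v) :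
    0 ≤ walkWeight w p :=
  Finset.sum_nonneg fun e he => hw e (p.edges_subset_edgeSet (List.mem_toFinset.1 he))

theorem walkWeight_concat_le (hw : ∀ e ∈ G.edgeSet, 0 ≤ w e) {u v v' : V} (p : G.Walk u v)
    (h : G.Adj v v') : walkWeight w (p.concat h) ≤ walkWeight w p + w s(v, v') := by
  have hvv : 0 ≤ w s(v, v') := hw _ h
  have : (p.concat h).edges.toFinset = insert s(v, v') p.edges.toFinset := by
    ext e; simp [SimpleGraph.Walk.edges_concat]
  rw [walkWeight, this, walkWeight]
  by_cases hm : s(v, v') ∈ p.edges.toFinset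
  · rw [Finset.insert_eq_of_mem hm]; linarith
  · rw [Finset.sum_insert hm]; linarith

theorem walkWeight_mapLe {G' : SimpleGraph V} (h : G ≤ G') {u v : V} (p : G.Walk u v) :
    walkWeight w (p.mapLe h) = walkWeight w p := by
  simp [walkWeight]

/-- A function that varies along each edge by at most the weight of the edge bounds the weights of
walks from below. -/
theorem sub_le_walkWeight (hw : ∀ e ∈ G.edgeSet, 0 ≤ w e) (f : V → ℝ)
    (hf : ∀ u v, G.Adj u v → f v - f u ≤ w s(u, v)) {u v : V} (p : G.Walk u v) :
    f v - f u ≤ walkWeight w p := by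
  have hlist : ∀ {u v : V} (q : G.Walk u v), f v - f u ≤ (q.edges.map w).sum := by
    intro u v q
    induction q with
    | nil => simp
    | cons h q ih =>
      rw [SimpleGraph.Walk.edges_cons, List.map_cons, List.sum_cons]
      linarith [hf _ _ h]
  -- A walk that repeats edges counts them once only, so it is first shortened to a path.
  calc f v - f u ≤ (p.bypass.edges.map w).sum := hlist _
    _ = walkWeight w p.bypass :=
      (List.sum_toFinset _ (p.bypass_isPath.isTrail.edges_nodup)).symm
    _ ≤ walkWeight w p := by
      refine Finset.sum_le_sum_of_subset_of_nonneg (fun e he => ?_) fun e he _ =>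
        hw e (p.edges_subset_edgeSet (List.mem_toFinset.1 he))
      exact List.mem_toFinset.2 (p.edges_bypass_subset_edges (List.mem_toFinset.1 he))

end Walks

theorem mem_edgeSet_stretch_ladder {n : ℕ} {e : Sym2 (ℕ × Fin 2)} :
    e ∈ (stretch {.X, .Y, .Z} n).edgeSet ↔
      (∃ i < n, e = s((i, 0), (i + 1, 0))) ∨ (∃ i < n, e = s((i, 1), (i + 1, 1))) ∨
        ∃ i ≤ n, e = s((i, 0), (i, 1)) := by
  simp only [stretch, SimpleGraph.edgeSet_fromEdgeSet, Set.mem_sdiff, Set.mem_iUnion,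
    Set.mem_insert_iff, Set.mem_singleton_iff, exists_prop, EdgeClass.edges]
  constructor
  · rintro ⟨⟨L, rfl | rfl | rfl, h⟩, -⟩
    · exact Or.inl h
    · exact Or.inr (Or.inl h)
    · exact Or.inr (Or.inr h)
  · rintro (⟨i, hi, rfl⟩ | ⟨i, hi, rfl⟩ | ⟨i, hi, rfl⟩)
    · exact ⟨⟨.X, by simp, i, hi, rfl⟩, by simp⟩
    · exact ⟨⟨.Y, by simp, i, hi, rfl⟩, by simp⟩
    · exact ⟨⟨.Z, by simp, i, hi, rfl⟩, by simp⟩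

theorem stretch_ladder_mono {m n : ℕ} (h : m ≤ n) :
    stretch {.X, .Y, .Z} m ≤ stretch {.X, .Y, .Z} n := by
  rw [← SimpleGraph.edgeSet_subset_edgeSet]
  intro e
  simp only [mem_edgeSet_stretch_ladder]
  rintro (⟨i, hi, rfl⟩ | ⟨i, hi, rfl⟩ | ⟨i, hi, rfl⟩)
  · exact Or.inl ⟨i, by omega, rfl⟩
  · exact Or.inr (Or.inl ⟨i, by omega, rfl⟩)
  · exact Or.inr (Or.inr ⟨i, by omega, rfl⟩)

theorem exists_walkWeight_le_ladderTimes {w : Sym2 (ℕ × Fin 2) → ℝ}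
    (hw : ∀ e ∈ stretchEdges {.X, .Y, .Z}, 0 ≤ w e) (n : ℕ) :
    let T := ladderTimes (fun i => w s((i, 0), (i + 1, 0))) (fun i => w s((i, 1), (i + 1, 1)))
      (fun i => w s((i, 0), (i, 1))) n
    (∃ p : (stretch {.X, .Y, .Z} n).Walk (0, 0) (n, 0), walkWeight w p ≤ T.1) ∧
      ∃ p : (stretch {.X, .Y, .Z} n).Walk (0, 0) (n, 1), walkWeight w p ≤ T.2 := by
  have hw' : ∀ n, ∀ e ∈ (stretch {.X, .Y, .Z} n).edgeSet, 0 ≤ w e := fun n e he =>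
    hw e (Set.mem_iUnion.2 ⟨n, he⟩)
  induction n with
  | zero =>
    have h0 : (stretch {.X, .Y, .Z} 0).Adj (0, 0) (0, 1) := by
      rw [← SimpleGraph.mem_edgeSet, mem_edgeSet_stretch_ladder]
      exact Or.inr (Or.inr ⟨0, le_rfl, rfl⟩)
    refine ⟨⟨.nil, by simp [walkWeight, ladderTimes]⟩, ⟨.cons h0 .nil, ?_⟩⟩
    simp [walkWeight, ladderTimes]
  | succ n ih =>
    obtain ⟨⟨p, hp⟩, ⟨q, hq⟩⟩ := ih
    have hx : (stretch {.X, .Y, .Z} (n + 1)).Adj (n, 0) (n + 1, 0) := by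
      rw [← SimpleGraph.mem_edgeSet, mem_edgeSet_stretch_ladder]
      exact Or.inl ⟨n, by omega, rfl⟩
    have hy : (stretch {.X, .Y, .Z} (n + 1)).Adj (n, 1) (n + 1, 1) := by
      rw [← SimpleGraph.mem_edgeSet, mem_edgeSet_stretch_ladder]
      exact Or.inr (Or.inl ⟨n, by omega, rfl⟩)
    have hz : (stretch {.X, .Y, .Z} (n + 1)).Adj (n + 1, 0) (n + 1, 1) := by
      rw [← SimpleGraph.mem_edgeSet, mem_edgeSet_stretch_ladder]
      exact Or.inr (Or.inr ⟨n + 1, by omega, rfl⟩)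
    have hle := stretch_ladder_mono (Nat.le_succ n)
    have hpx := (walkWeight_concat_le (hw' (n + 1)) (p.mapLe hle) hx)
    have hqy := (walkWeight_concat_le (hw' (n + 1)) (q.mapLe hle) hy)
    have hpz := walkWeight_concat_le (hw' (n + 1)) ((p.mapLe hle).concat hx) hz
    have hqz := walkWeight_concat_le (hw' (n + 1)) ((q.mapLe hle).concat hy) hz.symm
    rw [walkWeight_mapLe] at hpx hqy
    rw [Sym2.eq_swap] at hqz
    simp only [ladderTimes, ladderStep, le_min_iff] at hp hq ⊢
    constructor
    · rcases le_total (walkWeight w ((p.mapLe hle).concat hx))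
        (walkWeight w (((q.mapLe hle).concat hy).concat hz.symm)) with h | h
      · exact ⟨_, by linarith, h.trans (by linarith)⟩
      · exact ⟨_, h.trans (by linarith), by linarith⟩
    · rcases le_total (walkWeight w ((q.mapLe hle).concat hy))
        (walkWeight w (((p.mapLe hle).concat hx).concat hz)) with h | h
      · exact ⟨_, by linarith, h.trans (by linarith)⟩
      · exact ⟨_, h.trans (by linarith), by linarith⟩

/-- For nonnegative weights, the first-passage time in the ladder obeys the column recursion. -/
theorem firstPassageTime_ladder {w : Sym2 (ℕ × Fin 2) → ℝ}
    (hw : ∀ e ∈ stretchEdges {.X, .Y, .Z}, 0 ≤ w e) (n : ℕ) :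
    firstPassageTime (stretch {.X, .Y, .Z} n) w (0, 0) (n, 0) =
      (ladderTimes (fun i => w s((i, 0), (i + 1, 0))) (fun i => w s((i, 1), (i + 1, 1)))
        (fun i => w s((i, 0), (i, 1))) n).1 := by
  have hw' : ∀ n, ∀ e ∈ (stretch {.X, .Y, .Z} n).edgeSet, 0 ≤ w e := fun n e he =>
    hw e (Set.mem_iUnion.2 ⟨n, he⟩)
  have hX : ∀ i : ℕ, 0 ≤ w s((i, 0), (i + 1, 0)) := fun i =>
    hw' (i + 1) _ (mem_edgeSet_stretch_ladder.2 (Or.inl ⟨i, by omega, rfl⟩))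
  have hY : ∀ i : ℕ, 0 ≤ w s((i, 1), (i + 1, 1)) := fun i =>
    hw' (i + 1) _ (mem_edgeSet_stretch_ladder.2 (Or.inr (Or.inl ⟨i, by omega, rfl⟩)))
  have hZ : ∀ i : ℕ, 0 ≤ w s((i, 0), (i, 1)) := fun i =>
    hw' i _ (mem_edgeSet_stretch_ladder.2 (Or.inr (Or.inr ⟨i, by omega, rfl⟩)))
  obtain ⟨⟨p₀, hp₀⟩, -⟩ := exists_walkWeight_le_ladderTimes hw n
  refine le_antisymm ((ciInf_le ⟨0, ?_⟩ p₀).trans hp₀) ?_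
  · rintro _ ⟨p, rfl⟩
    exact walkWeight_nonneg (hw' n) p
  have : Nonempty ((stretch {.X, .Y, .Z} n).Walk (0, 0) (n, 0)) := ⟨p₀⟩
  -- The detour of length `Z n` is no shorter than the last rung, hence changes nothing.
  obtain ⟨f, g, h, hf, -⟩ := exists_isLadderPotential hX hY hZ n _ (hZ n)
  have hab := abs_ladderTimes_sub_le (X := fun i : ℕ => w s((i, 0), (i + 1, 0)))
    (Y := fun i => w s((i, 1), (i + 1, 1))) hZ n
  rw [min_eq_left (by linarith [neg_le_of_abs_le hab])] at hf
  refine le_ciInf fun p => ?_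
  have key := sub_le_walkWeight (hw' n) (fun v => if v.2 = 0 then f v.1 else g v.1) ?_ p
  · simpa [h.zero, hf] using key
  · intro u v huv
    rw [← SimpleGraph.mem_edgeSet, mem_edgeSet_stretch_ladder] at huv
    rcases huv with ⟨i, hi, he⟩ | ⟨i, hi, he⟩ | ⟨i, hi, he⟩
    · have := abs_le.1 (h.row₀ i hi)
      rw [he]
      rcases Sym2.eq_iff.1 he with ⟨rfl, rfl⟩ | ⟨rfl, rfl⟩ <;> simp <;> linarith
    · have := abs_le.1 (h.row₁ i hi)
      rw [he]
      rcases Sym2.eq_iff.1 he with ⟨rfl, rfl⟩ | ⟨rfl, rfl⟩ <;> simp <;> linarith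
    · have := abs_le.1 (h.rung i hi)
      rw [he]
      rcases Sym2.eq_iff.1 he with ⟨rfl, rfl⟩ | ⟨rfl, rfl⟩ <;> simp <;> linarith

/-! ### Integrals against the exponential law -/

instance isProbabilityMeasure_expMeasure_one : IsProbabilityMeasure (expMeasure 1) :=
  isProbabilityMeasure_expMeasure one_pos

theorem expMeasure_one_eq :
    expMeasure 1 = (volume.restrict (Set.Ioi (0 : ℝ))).withDensity
      fun x => ENNReal.ofReal (Real.exp (-x)) := by
  rw [expMeasure, gammaMeasure, restrict_Ioi_eq_restrict_Ici,
    ← withDensity_indicator measurableSet_Ici]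
  congr 1
  ext x
  by_cases hx : 0 ≤ x
  · simp [Set.indicator, gammaPDF, gammaPDFReal, hx]
  · simp [Set.indicator, gammaPDF, gammaPDFReal, hx]

theorem ae_expMeasure_one_pos : ∀ᵐ x ∂expMeasure 1, 0 < x := by
  rw [expMeasure_one_eq]
  exact (withDensity_absolutelyContinuous _ _).ae_le (ae_restrict_mem measurableSet_Ioi)

theorem integrable_expMeasure_one_iff {f : ℝ → ℝ} :
    Integrable f (expMeasure 1) ↔
      IntegrableOn (fun x => f x * Real.exp (-x)) (Set.Ioi 0) := by
  rw [expMeasure_one_eq, integrable_withDensity_iff (by fun_prop) (by simp)]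
  simp [IntegrableOn, ENNReal.toReal_ofReal, Real.exp_nonneg]

theorem integral_expMeasure_one (f : ℝ → ℝ) :
    ∫ x, f x ∂expMeasure 1 = ∫ x in Set.Ioi 0, f x * Real.exp (-x) := by
  rw [expMeasure_one_eq, integral_withDensity_eq_integral_toReal_smul (by fun_prop) (by simp)]
  simp [ENNReal.toReal_ofReal, Real.exp_nonneg, mul_comm]

/-- The fundamental theorem of calculus for the exponential law and an integrand that is given by
two formulas, on `[0, s]` and on `[s, ∞)`. -/
theorem integral_expMeasure_one_of_hasDerivAt {f F₁ F₂ : ℝ → ℝ} {s : ℝ} (hs : 0 ≤ s)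
    (hf : Continuous f) (hf₀ : ∀ x, 0 ≤ f x)
    (h₁ : ∀ x ∈ Set.Icc 0 s, HasDerivAt F₁ (f x * Real.exp (-x)) x)
    (h₂ : ∀ x ∈ Set.Ici s, HasDerivAt F₂ (f x * Real.exp (-x)) x)
    (hlim : Tendsto F₂ atTop (𝓝 0)) :
    Integrable f (expMeasure 1) ∧ ∫ x, f x ∂expMeasure 1 = F₁ s - F₁ 0 - F₂ s := by
  have hc : Continuous fun x => f x * Real.exp (-x) := by fun_prop
  have hi₁ : IntegrableOn (fun x => f x * Real.exp (-x)) (Set.Ioc 0 s) :=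
    (hc.integrableOn_Icc).mono_set Set.Ioc_subset_Icc_self
  have hi₂ : IntegrableOn (fun x => f x * Real.exp (-x)) (Set.Ioi s) :=
    integrableOn_Ioi_deriv_of_nonneg' h₂ (fun x _ => mul_nonneg (hf₀ x) (Real.exp_nonneg _)) hlim
  have hu : Set.Ioi (0 : ℝ) = Set.Ioc 0 s ∪ Set.Ioi s := (Set.Ioc_union_Ioi_eq_Ioi hs).symm
  refine ⟨integrable_expMeasure_one_iff.2 (hu ▸ hi₁.union hi₂), ?_⟩
  rw [integral_expMeasure_one, hu,
    setIntegral_union (Set.Ioc_disjoint_Ioi le_rfl) measurableSet_Ioi hi₁ hi₂,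
    integral_Ioi_of_hasDerivAt_of_tendsto' h₂ hi₂ hlim,
    ← intervalIntegral.integral_of_le hs,
    intervalIntegral.integral_eq_sub_of_hasDerivAt
      (fun x hx => h₁ x (by rwa [Set.uIcc_of_le hs] at hx)) (hc.intervalIntegrable _ _)]
  ring

theorem tendsto_exp_neg_mul_atTop {l : ℝ} (hl : 0 < l) :
    Tendsto (fun x => Real.exp (-l * x)) atTop (𝓝 0) :=
  Real.tendsto_exp_neg_atTop_nhds_zero.comp (tendsto_id.const_mul_atTop hl) |>.congr
    fun x => by simp

theorem hasDerivAt_exp_const_mul (c x : ℝ) :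
    HasDerivAt (fun x => Real.exp (c * x)) (c * Real.exp (c * x)) x := by
  simpa [mul_comm] using ((hasDerivAt_id x).const_mul c).exp

theorem integral_exp_neg_mul_expMeasure_one {l : ℝ} (hl : 0 ≤ l) :
    Integrable (fun x => Real.exp (-(l * x))) (expMeasure 1) ∧
      ∫ x, Real.exp (-(l * x)) ∂expMeasure 1 = 1 / (l + 1) := by
  have hl' : l + 1 ≠ 0 := by positivity
  have hd : ∀ x, HasDerivAt (fun x => -(Real.exp (-(l + 1) * x) / (l + 1)))
      (Real.exp (-(l * x)) * Real.exp (-x)) x := fun x => by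
    refine (((hasDerivAt_exp_const_mul (-(l + 1)) x).div_const (l + 1)).neg).congr_deriv ?_
    rw [← Real.exp_add, show -(l * x) + -x = -(l + 1) * x by ring]
    field_simp
  have hlim : Tendsto (fun x => -(Real.exp (-(l + 1) * x) / (l + 1))) atTop (𝓝 0) := by
    simpa only [zero_div, neg_zero] using
      ((tendsto_exp_neg_mul_atTop (show 0 < l + 1 by positivity)).div_const (l + 1)).neg
  have := integral_expMeasure_one_of_hasDerivAt le_rfl (by fun_prop)
    (fun x => Real.exp_nonneg _) (fun x _ => hd x) (fun x _ => hd x) hlim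
  simpa using this

theorem integral_exp_neg_mul_min_expMeasure_one {l u : ℝ} (hl : 0 ≤ l) (hu : 0 ≤ u) :
    ∫ z, Real.exp (-(l * min z u)) ∂expMeasure 1 =
      1 / (l + 1) + l / (l + 1) * Real.exp (-((l + 1) * u)) := by
  have hl' : l + 1 ≠ 0 := by positivity
  have := (integral_expMeasure_one_of_hasDerivAt (f := fun z => Real.exp (-(l * min z u)))
    (F₁ := fun x => -(Real.exp (-(l + 1) * x) / (l + 1)))
    (F₂ := fun x => -(Real.exp (-(l * u)) * Real.exp ((-1) * x))) hu (by fun_prop)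
    (fun x => Real.exp_nonneg _) ?_ ?_ ?_).2
  · rw [this]
    have : Real.exp (-(l * u)) * Real.exp (-1 * u) = Real.exp (-((l + 1) * u)) := by
      rw [← Real.exp_add]; ring_nf
    rw [this, mul_zero, Real.exp_zero, neg_mul]
    field_simp
    ring
  · intro x hx
    refine (((hasDerivAt_exp_const_mul (-(l + 1)) x).div_const (l + 1)).neg).congr_deriv ?_
    rw [min_eq_left hx.2, ← Real.exp_add, show -(l * x) + -x = -(l + 1) * x by ring]
    field_simp
  · intro x hx
    refine (((hasDerivAt_exp_const_mul (-1) x).const_mul _).neg).congr_deriv ?_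
    rw [min_eq_right hx]
    simp
  · simpa using ((tendsto_exp_neg_mul_atTop one_pos).const_mul (Real.exp (-(l * u)))).neg

theorem integral_exp_neg_mul_abs_sub_expMeasure_one {l s : ℝ} (hl : 1 < l) (hs : 0 ≤ s) :
    ∫ x, Real.exp (-(l * |s - x|)) ∂expMeasure 1 =
      (Real.exp (-s) - Real.exp (-(l * s))) / (l - 1) + Real.exp (-s) / (l + 1) := by
  have hl' : l + 1 ≠ 0 := by positivity
  have hl'' : l - 1 ≠ 0 := by linarith
  have := (integral_expMeasure_one_of_hasDerivAt (f := fun x => Real.exp (-(l * |s - x|)))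
    (F₁ := fun x => Real.exp (-(l * s)) * Real.exp ((l - 1) * x) / (l - 1))
    (F₂ := fun x => -(Real.exp (l * s) * Real.exp (-(l + 1) * x) / (l + 1))) hs (by fun_prop)
    (fun x => Real.exp_nonneg _) ?_ ?_ ?_).2
  · rw [this]
    have h1 : Real.exp (-(l * s)) * Real.exp ((l - 1) * s) = Real.exp (-s) := by
      rw [← Real.exp_add]; ring_nf
    have h2 : Real.exp (l * s) * Real.exp (-(l + 1) * s) = Real.exp (-s) := by
      rw [← Real.exp_add]; ring_nf
    rw [h1, h2, mul_zero, Real.exp_zero, mul_one]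
    ring
  · intro x hx
    refine (((hasDerivAt_exp_const_mul (l - 1) x).const_mul _).div_const (l - 1)).congr_deriv ?_
    rw [abs_of_nonneg (sub_nonneg.2 hx.2), ← Real.exp_add, mul_left_comm, ← Real.exp_add,
      show -(l * (s - x)) + -x = -(l * s) + (l - 1) * x by ring]
    field_simp
  · intro x hx
    refine (((hasDerivAt_exp_const_mul (-(l + 1)) x).const_mul _).div_const (l + 1)).neg.congr_deriv
      ?_
    rw [abs_of_nonpos (sub_nonpos.2 hx), ← Real.exp_add, mul_left_comm, ← Real.exp_add,
      show -(l * -(s - x)) + -x = l * s + -(l + 1) * x by ring]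
    field_simp
  · simpa only [mul_zero, zero_div, neg_zero] using
      (((tendsto_exp_neg_mul_atTop (show 0 < l + 1 by positivity)).const_mul
        (Real.exp (l * s))).div_const (l + 1)).neg

theorem tendsto_mul_exp_neg_atTop (c d : ℝ) :
    Tendsto (fun x => (d * x + c) * Real.exp (-x)) atTop (𝓝 0) := by
  have h1 := (Real.tendsto_pow_mul_exp_neg_atTop_nhds_zero 1).const_mul d
  have h0 := (Real.tendsto_pow_mul_exp_neg_atTop_nhds_zero 0).const_mul c
  simpa [add_mul, mul_assoc] using h1.add h0

theorem integral_abs_sub_expMeasure_one {s : ℝ} (hs : 0 ≤ s) :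
    ∫ x, |s - x| ∂expMeasure 1 = s - 1 + 2 * Real.exp (-s) := by
  have hexp : ∀ x, HasDerivAt (fun x => Real.exp (-x)) (-Real.exp (-x)) x := fun x => by
    simpa using (hasDerivAt_neg x).exp
  have hlin : ∀ x, HasDerivAt (fun x : ℝ => 1 * x + (1 - s)) 1 x := fun x => by
    simpa using (hasDerivAt_id x).add_const (1 - s)
  have := (integral_expMeasure_one_of_hasDerivAt (f := fun x => |s - x|)
    (F₁ := fun x => (1 * x + (1 - s)) * Real.exp (-x))
    (F₂ := fun x => -((1 * x + (1 - s)) * Real.exp (-x))) hs (by fun_prop)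
    (fun x => abs_nonneg _) ?_ ?_ ?_).2
  · rw [this]
    simp
    ring
  · intro x hx
    refine ((hlin x).mul (hexp x)).congr_deriv ?_
    rw [abs_of_nonneg (sub_nonneg.2 hx.2)]
    ring
  · intro x hx
    refine ((hlin x).mul (hexp x)).neg.congr_deriv ?_
    rw [abs_of_nonpos (sub_nonpos.2 hx)]
    ring
  · simpa using (tendsto_mul_exp_neg_atTop (1 - s) 1).neg

theorem integrable_sq_expMeasure_one : Integrable (fun x => x ^ 2) (expMeasure 1) := by
  have hexp : ∀ x, HasDerivAt (fun x => Real.exp (-x)) (-Real.exp (-x)) x := fun x => by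
    simpa using (hasDerivAt_neg x).exp
  have hquad : ∀ x, HasDerivAt (fun x : ℝ => x ^ 2 + (2 * x + 2)) (2 * x + 2) x := fun x => by
    refine ((hasDerivAt_pow 2 x).add (((hasDerivAt_id x).const_mul 2).add_const 2)).congr_deriv ?_
    simp
  have hd : ∀ x, HasDerivAt (fun x => -((x ^ 2 + (2 * x + 2)) * Real.exp (-x)))
      (x ^ 2 * Real.exp (-x)) x := fun x => by
    refine ((hquad x).mul (hexp x)).neg.congr_deriv ?_
    ring
  refine (integral_expMeasure_one_of_hasDerivAt le_rfl (by fun_prop)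
    (fun x => sq_nonneg x) (fun x _ => hd x) (fun x _ => hd x) ?_).1
  simpa [add_mul] using ((Real.tendsto_pow_mul_exp_neg_atTop_nhds_zero 2).add
    (tendsto_mul_exp_neg_atTop 2 2)).neg

theorem memLp_two_id_expMeasure_one : MemLp (fun x => x) 2 (expMeasure 1) :=
  (memLp_two_iff_integrable_sq (by fun_prop)).2 integrable_sq_expMeasure_one

theorem integrable_id_expMeasure_one : Integrable (fun x => x) (expMeasure 1) :=
  memLp_two_id_expMeasure_one.integrable (by norm_num)

theorem integral_id_expMeasure_one : ∫ x, x ∂expMeasure 1 = 1 := by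
  have h := integral_abs_sub_expMeasure_one le_rfl
  rw [← sub_eq_zero] at h ⊢
  rw [← h, neg_zero, Real.exp_zero, integral_congr_ae
    (ae_expMeasure_one_pos.mono fun x hx => show |0 - x| = x by simp [abs_of_pos hx])]
  ring

theorem integrable_exp_neg_mul_abs {α : Type*} [MeasurableSpace α] {μ : Measure α}
    [IsFiniteMeasure μ] {f : α → ℝ} (hf : Measurable f) {l : ℝ} (hl : 0 ≤ l) :
    Integrable (fun x => Real.exp (-(l * |f x|))) μ :=
  Integrable.of_bound (C := 1) (by fun_prop) (Eventually.of_forall fun x => by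
    rw [Real.norm_of_nonneg (Real.exp_nonneg _), Real.exp_le_one_iff]
    have := mul_nonneg hl (abs_nonneg (f x))
    linarith)

/-- The law of `|c + y - x|`, for independent exponential variables `x` and `y`, is the same for `c`
as for `-c`; so integrals against it need only be computed for `c ≥ 0`. -/
theorem integral_integral_abs_add_sub {f : ℝ → ℝ} {g : ℝ → ℝ}
    (hint : ∀ c, Integrable (fun p : ℝ × ℝ => f |c + p.1 - p.2|)
      ((expMeasure 1).prod (expMeasure 1)))
    (h : ∀ c, 0 ≤ c → ∫ y, ∫ x, f |c + y - x| ∂expMeasure 1 ∂expMeasure 1 = g c) (c : ℝ) :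
    ∫ x, ∫ y, f |c + y - x| ∂expMeasure 1 ∂expMeasure 1 = g |c| := by
  rcases le_total 0 c with hc | hc
  · rw [abs_of_nonneg hc, ← h c hc, integral_integral_swap]
    exact (hint c).swap
  · rw [abs_of_nonpos hc, ← h (-c) (neg_nonneg.2 hc)]
    congr! 5 with x y
    rw [← abs_neg]
    ring_nf

theorem integral_integral_exp_neg_mul_abs {l : ℝ} (hl : 1 < l) (c : ℝ) :
    ∫ x, ∫ y, Real.exp (-(l * |c + y - x|)) ∂expMeasure 1 ∂expMeasure 1 =
      (l * Real.exp (-|c|) - Real.exp (-(l * |c|))) / (l ^ 2 - 1) := by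
  refine integral_integral_abs_add_sub (f := fun d => Real.exp (-(l * d)))
    (g := fun d => (l * Real.exp (-d) - Real.exp (-(l * d))) / (l ^ 2 - 1))
    (fun c => integrable_exp_neg_mul_abs (by fun_prop) (by linarith)) (fun c hc => ?_) c
  have hl' : l + 1 ≠ 0 := by positivity
  have hl'' : l - 1 ≠ 0 := by linarith
  have hl2 : l ^ 2 - 1 ≠ 0 := by nlinarith
  have hae : ∀ᵐ y ∂expMeasure 1, ∫ x, Real.exp (-(l * |c + y - x|)) ∂expMeasure 1 =
      (Real.exp (-c) / (l - 1) + Real.exp (-c) / (l + 1)) * Real.exp (-(1 * y)) -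
        Real.exp (-(l * c)) / (l - 1) * Real.exp (-(l * y)) := by
    filter_upwards [ae_expMeasure_one_pos] with y hy
    rw [integral_exp_neg_mul_abs_sub_expMeasure_one hl (by positivity), neg_add, Real.exp_add,
      mul_add, neg_add, Real.exp_add, one_mul]
    ring
  have h1 := integral_exp_neg_mul_expMeasure_one zero_le_one
  have h2 := integral_exp_neg_mul_expMeasure_one (l := l) (by linarith)
  rw [integral_congr_ae hae, integral_sub (h1.1.const_mul _) (h2.1.const_mul _),
    integral_const_mul, integral_const_mul, h1.2, h2.2]
  field_simp
  ring

theorem integral_integral_abs (c : ℝ) :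
    ∫ x, ∫ y, |c + y - x| ∂expMeasure 1 ∂expMeasure 1 = |c| + Real.exp (-|c|) := by
  have hi := integrable_id_expMeasure_one
  refine integral_integral_abs_add_sub (f := fun d => d) (g := fun d => d + Real.exp (-d))
    (fun c => (((integrable_const c).add (hi.comp_fst _)).sub (hi.comp_snd _)).abs)
    (fun c hc => ?_) c
  have hae : ∀ᵐ y ∂expMeasure 1, ∫ x, |c + y - x| ∂expMeasure 1 =
      (c - 1) + y + 2 * Real.exp (-c) * Real.exp (-(1 * y)) := by
    filter_upwards [ae_expMeasure_one_pos] with y hy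
    rw [integral_abs_sub_expMeasure_one (by positivity), neg_add, Real.exp_add, one_mul]
    ring
  have h1 := integral_exp_neg_mul_expMeasure_one zero_le_one
  rw [integral_congr_ae hae, integral_add (integrable_const_add_iff.2 hi) (h1.1.const_mul _),
    integral_add (integrable_const _) hi, integral_const_mul, h1.2, integral_id_expMeasure_one]
  simp
  ring

/-! ### Bessel functions at `2` -/

theorem hasSum_besselJ_two (m : ℕ) :
    HasSum (fun k : ℕ => (-1 : ℝ) ^ k / ((k ! : ℝ) * ((k + m)! : ℝ))) (besselJ m 2) := by
  have := (summable_besselJ m 2).hasSum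
  simpa [besselJ] using this

theorem besselJ_two_mem_Icc (m n : ℕ) :
    besselJ m 2 ∈ Set.Icc
      (∑ k ∈ Finset.range (2 * n), (-1 : ℝ) ^ k / ((k ! : ℝ) * ((k + m)! : ℝ)))
      (∑ k ∈ Finset.range (2 * n + 1), (-1 : ℝ) ^ k / ((k ! : ℝ) * ((k + m)! : ℝ))) := by
  have ha : Antitone fun k : ℕ => 1 / ((k ! : ℝ) * ((k + m)! : ℝ)) :=
    antitone_nat_of_succ_le fun k => by
      have h1 : (k ! : ℝ) ≤ ((k + 1)! : ℝ) := by exact_mod_cast Nat.factorial_le (by omega)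
      have h2 : ((k + m)! : ℝ) ≤ ((k + 1 + m)! : ℝ) := by
        exact_mod_cast Nat.factorial_le (by omega)
      gcongr
  have ht := (hasSum_besselJ_two m).tendsto_sum_nat
  simp only [div_eq_mul_one_div ((-1 : ℝ) ^ _)] at ht ⊢
  exact ⟨ha.alternating_series_le_tendsto ht n, ha.tendsto_le_alternating_series ht n⟩

theorem besselJ_one_two_mem_Icc : besselJ 1 2 ∈ Set.Icc (0.5763 : ℝ) 0.5768 := by
  have h := besselJ_two_mem_Icc 1 2
  norm_num [Finset.sum_range_succ, Nat.factorial] at h ⊢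
  constructor <;> linarith [h.1, h.2]

theorem besselJ_two_two_mem_Icc : besselJ 2 2 ∈ Set.Icc (0.3527 : ℝ) 0.3529 := by
  have h := besselJ_two_mem_Icc 2 2
  norm_num [Finset.sum_range_succ, Nat.factorial] at h ⊢
  constructor <;> linarith [h.1, h.2]

theorem besselJ_two_two_pos : 0 < besselJ 2 2 :=
  lt_of_lt_of_le (by norm_num) besselJ_two_two_mem_Icc.1

/-- The value of the time constant of the ladder. -/
noncomputable def ladderRate : ℝ :=
  3 / 2 - besselJ 1 2 / (2 * besselJ 2 2)

theorem ladderRate_mem_Ico : ladderRate ∈ Set.Ico (0.68 : ℝ) 0.69 := by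
  obtain ⟨h1, h1'⟩ := besselJ_one_two_mem_Icc
  obtain ⟨h2, h2'⟩ := besselJ_two_two_mem_Icc
  have hpos := besselJ_two_two_pos
  have hle : besselJ 1 2 / (2 * besselJ 2 2) ≤ 0.82 := by
    rw [div_le_iff₀ (by positivity)]
    linarith
  have hgt : 0.81 < besselJ 1 2 / (2 * besselJ 2 2) := by
    rw [lt_div_iff₀ (by positivity)]
    linarith
  constructor <;> rw [ladderRate] <;> linarith

/-- This is the recurrence `J₀ + J₂ = J₁` at `2`, with the first two terms of the series of `J₀`,
whose sum is zero there, left out. -/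
theorem hasSum_sq_factorial :
    HasSum (fun k : ℕ => (-1 : ℝ) ^ k / ((k + 2)! : ℝ) ^ 2) (besselJ 1 2 - besselJ 2 2) := by
  have h1 := (hasSum_nat_add_iff' 2).2 (hasSum_besselJ_two 1)
  have h2 := (hasSum_nat_add_iff' 1).2 (hasSum_besselJ_two 2)
  convert! h1.sub h2 using 1
  · ext k
    have : ((k + 2 + 1)! : ℝ) = (k + 3) * (k + 2)! := by
      rw [Nat.factorial_succ]; push_cast; ring
    rw [show k + 1 + 2 = k + 2 + 1 by ring, this]
    have : ((k + 2)! : ℝ) = (k + 2) * (k + 1)! := by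
      rw [Nat.factorial_succ]; push_cast; ring
    rw [this, pow_add, pow_add]
    have : ((k + 1)! : ℝ) ≠ 0 := by positivity
    have : (k : ℝ) + 2 ≠ 0 := by positivity
    have : (k : ℝ) + 3 ≠ 0 := by positivity
    field_simp
    ring
  · norm_num [Finset.sum_range_succ, Nat.factorial]

/-! ### The Poisson equation -/

/-- The coefficients of `ladderCorrector` as a power series in `exp (-|d|)`, without constant
term. -/
noncomputable def correctorCoeff (k : ℕ) : ℝ :=
  -(1 / (2 * besselJ 2 2)) * ((-1) ^ k / (((k + 1)! : ℝ) * ((k + 2)! : ℝ)))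

theorem correctorCoeff_zero : correctorCoeff 0 = -(1 / (4 * besselJ 2 2)) := by
  have := besselJ_two_two_pos.ne'
  simp [correctorCoeff]
  field_simp
  norm_num

theorem correctorCoeff_succ (k : ℕ) :
    correctorCoeff (k + 1) = -correctorCoeff k / ((k + 2) * (k + 3)) := by
  have h2 : ((k + 1 + 1)! : ℝ) = (k + 2) * (k + 1)! := by
    rw [Nat.factorial_succ]; push_cast; ring
  have h3 : ((k + 1 + 2)! : ℝ) = (k + 3) * (k + 2)! := by
    rw [show k + 1 + 2 = k + 2 + 1 by ring, Nat.factorial_succ]; push_cast; ring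
  rw [correctorCoeff, correctorCoeff, h3, h2, pow_succ]
  have := besselJ_two_two_pos.ne'
  have : ((k + 1)! : ℝ) ≠ 0 := by positivity
  have : ((k + 2)! : ℝ) ≠ 0 := by positivity
  have : (k : ℝ) + 2 ≠ 0 := by positivity
  have : (k : ℝ) + 3 ≠ 0 := by positivity
  field_simp

theorem summable_correctorCoeff : Summable correctorCoeff := by
  have := ((summable_nat_add_iff 1).2 (hasSum_besselJ_two 1).summable).mul_left
    (1 / (2 * besselJ 2 2))
  refine this.congr fun k => ?_
  rw [correctorCoeff, pow_succ, show k + 1 + 1 = k + 2 by ring]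
  ring

theorem hasSum_correctorCoeff_div_add_two :
    HasSum (fun k => correctorCoeff k / (k + 2)) (ladderRate - 1) := by
  convert! hasSum_sq_factorial.mul_left (-(1 / (2 * besselJ 2 2))) using 1
  · ext k
    have h2 : ((k + 2)! : ℝ) = (k + 2) * (k + 1)! := by
      rw [Nat.factorial_succ]; push_cast; ring
    rw [correctorCoeff, h2]
    have := besselJ_two_two_pos.ne'
    have : ((k + 1)! : ℝ) ≠ 0 := by positivity
    have : (k : ℝ) + 2 ≠ 0 := by positivity
    field_simp
  · have := besselJ_two_two_pos.ne'
    rw [ladderRate]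
    field_simp
    ring

theorem hasSum_correctorCoeff_div_add_three :
    HasSum (fun k => correctorCoeff k / (k + 3)) (correctorCoeff 0 + 1 / 2) := by
  have h := (hasSum_nat_add_iff' 1).2 (hasSum_besselJ_two 2)
  convert! h.mul_left (1 / (2 * besselJ 2 2)) using 1
  · ext k
    have h3 : ((k + 1 + 2)! : ℝ) = (k + 3) * (k + 2)! := by
      rw [show k + 1 + 2 = k + 2 + 1 by ring, Nat.factorial_succ]; push_cast; ring
    rw [correctorCoeff, h3, pow_succ]
    have := besselJ_two_two_pos.ne'
    have : ((k + 1)! : ℝ) ≠ 0 := by positivity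
    have : ((k + 2)! : ℝ) ≠ 0 := by positivity
    have : (k : ℝ) + 3 ≠ 0 := by positivity
    field_simp
  · have := besselJ_two_two_pos.ne'
    rw [correctorCoeff_zero]
    norm_num [Nat.factorial]
    field_simp
    ring

/-- The function of the difference `d` of the passage times to the two vertices of a column that
solves the Poisson equation of the ladder: adding it to the smaller of the two passage times makes
the expected increment from column to column equal to `ladderRate`, whatever `d` is. Its derivative
at `d > 0` is a multiple of `J₂ (2 * exp (-d / 2))`. -/
noncomputable def ladderCorrector (d : ℝ) : ℝ :=
  ∑' k, correctorCoeff k * Real.exp (-((k + 1) * |d|))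

theorem norm_correctorCoeff_mul_exp_le (k : ℕ) (d : ℝ) :
    ‖correctorCoeff k * Real.exp (-((k + 1) * |d|))‖ ≤ |correctorCoeff k| := by
  rw [norm_mul, Real.norm_of_nonneg (Real.exp_nonneg _), Real.norm_eq_abs]
  refine mul_le_of_le_one_right (abs_nonneg _) (Real.exp_le_one_iff.2 ?_)
  have : 0 ≤ ((k : ℝ) + 1) * |d| := by positivity
  linarith

theorem hasSum_ladderCorrector (d : ℝ) :
    HasSum (fun k : ℕ => correctorCoeff k * Real.exp (-((k + 1) * |d|))) (ladderCorrector d) :=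
  (Summable.of_norm_bounded summable_correctorCoeff.abs
    fun k => norm_correctorCoeff_mul_exp_le k d).hasSum

theorem abs_ladderCorrector_le (d : ℝ) : |ladderCorrector d| ≤ ∑' k, |correctorCoeff k| :=
  tsum_of_norm_bounded summable_correctorCoeff.abs.hasSum
    fun k => norm_correctorCoeff_mul_exp_le k d

theorem continuous_ladderCorrector : Continuous ladderCorrector :=
  continuous_tsum (fun k => by fun_prop) summable_correctorCoeff.abs
    fun k d => norm_correctorCoeff_mul_exp_le k d

/-- The joint law of the weights of the three edges that a column adds to the ladder. -/
noncomputable def columnLaw : Measure (ℝ × ℝ × ℝ) :=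
  (expMeasure 1).prod ((expMeasure 1).prod (expMeasure 1))

instance : IsProbabilityMeasure columnLaw := by
  unfold columnLaw; infer_instance

theorem measurable_ladderStep : Measurable fun p : (ℝ × ℝ) × ℝ × ℝ × ℝ => ladderStep p.1 p.2 := by
  unfold ladderStep; fun_prop

theorem measurable_ladderStep_left (t : ℝ × ℝ) : Measurable (ladderStep t) :=
  measurable_ladderStep.comp measurable_prodMk_left

theorem measurePreserving_fst_columnLaw :
    MeasurePreserving (fun u : ℝ × ℝ × ℝ => u.1) columnLaw (expMeasure 1) :=
  measurePreserving_fst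

theorem measurePreserving_snd_fst_columnLaw :
    MeasurePreserving (fun u : ℝ × ℝ × ℝ => u.2.1) columnLaw (expMeasure 1) :=
  measurePreserving_fst.comp measurePreserving_snd

theorem measurePreserving_snd_snd_columnLaw :
    MeasurePreserving (fun u : ℝ × ℝ × ℝ => u.2.2) columnLaw (expMeasure 1) :=
  measurePreserving_snd.comp measurePreserving_snd

theorem ae_columnLaw_pos : ∀ᵐ u ∂columnLaw, 0 < u.2.2 :=
  measurePreserving_snd_snd_columnLaw.quasiMeasurePreserving.ae ae_expMeasure_one_pos

theorem integral_columnLaw {f : ℝ × ℝ × ℝ → ℝ} (hf : Integrable f columnLaw) :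
    ∫ u, f u ∂columnLaw =
      ∫ x, ∫ y, ∫ z, f (x, y, z) ∂expMeasure 1 ∂expMeasure 1 ∂expMeasure 1 := by
  rw [columnLaw, integral_prod f hf]
  refine integral_congr_ae ?_
  filter_upwards [Integrable.prod_right_ae hf] with x hx
  exact integral_prod _ hx

theorem integral_min_ladderStep (t : ℝ × ℝ) :
    ∫ u, min (ladderStep t u).1 (ladderStep t u).2 ∂columnLaw =
      min t.1 t.2 + 1 - Real.exp (-|t.2 - t.1|) / 2 := by
  have hi := integrable_id_expMeasure_one
  have hx : Integrable (fun u : ℝ × ℝ × ℝ => u.1) columnLaw :=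
    measurePreserving_fst_columnLaw.integrable_comp_of_integrable hi
  have hy : Integrable (fun u : ℝ × ℝ × ℝ => u.2.1) columnLaw :=
    measurePreserving_snd_fst_columnLaw.integrable_comp_of_integrable hi
  have hx' : ∫ u, u.1 ∂columnLaw = 1 := by
    have := measurePreserving_fst_columnLaw.map_eq
    rw [← integral_id_expMeasure_one, ← this, integral_map (by fun_prop) (by fun_prop)]
  have hy' : ∫ u, u.2.1 ∂columnLaw = 1 := by
    have := measurePreserving_snd_fst_columnLaw.map_eq
    rw [← integral_id_expMeasure_one, ← this, integral_map (by fun_prop) (by fun_prop)]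
  have hc₁ : Integrable (fun u : ℝ × ℝ × ℝ => t.1 + t.2 + u.1) columnLaw :=
    (integrable_const _).add hx
  have hc₂ : Integrable (fun u : ℝ × ℝ × ℝ => t.1 + t.2 + u.1 + u.2.1) columnLaw := hc₁.add hy
  have hd : Integrable (fun u : ℝ × ℝ × ℝ => |t.2 - t.1 + u.2.1 - u.1|) columnLaw :=
    (((integrable_const _).add hy).sub hx).abs
  have hmin : ∀ a b : ℝ, min a b = ((a + b) - |b - a|) / 2 := fun a b => by
    rw [← max_sub_min_eq_abs a b, ← min_add_max a b]
    ring
  have hae : ∀ᵐ u ∂columnLaw, min (ladderStep t u).1 (ladderStep t u).2 =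
      (((t.1 + t.2) + u.1 + u.2.1) - |t.2 - t.1 + u.2.1 - u.1|) / 2 := by
    filter_upwards [ae_columnLaw_pos] with u hu
    rw [min_ladderStep, min_eq_left hu.le, add_zero, hmin]
    ring_nf
  rw [integral_congr_ae hae, integral_div,
    integral_sub hc₂ hd, integral_add hc₁ hy, integral_add (integrable_const _) hx, hx', hy',
    integral_columnLaw hd]
  simp only [integral_const, probReal_univ, one_smul, integral_integral_abs, hmin]
  ring

theorem integral_exp_ladderStep (t : ℝ × ℝ) (k : ℕ) :
    ∫ u, Real.exp (-((k + 1) * |(ladderStep t u).2 - (ladderStep t u).1|)) ∂columnLaw =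
      1 / (k + 2) + Real.exp (-|t.2 - t.1|) / (k + 3) -
        Real.exp (-((k + 2) * |t.2 - t.1|)) / ((k + 2) * (k + 3)) := by
  have hk : (0 : ℝ) ≤ k + 1 := by positivity
  have hae : ∀ᵐ u ∂columnLaw,
      Real.exp (-((k + 1) * |(ladderStep t u).2 - (ladderStep t u).1|)) =
        Real.exp (-((k + 1) * |min u.2.2 (|t.2 - t.1 + u.2.1 - u.1|)|)) := by
    filter_upwards [ae_columnLaw_pos] with u hu
    rw [abs_ladderStep_sub hu.le, abs_of_nonneg (le_min hu.le (abs_nonneg _))]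
  have hz : ∀ c : ℝ, ∫ z, Real.exp (-((k + 1) * |min z (|c|)|)) ∂expMeasure 1 =
      1 / (k + 1 + 1) + (k + 1) / (k + 1 + 1) * Real.exp (-((k + 1 + 1) * |c|)) := fun c => by
    rw [← integral_exp_neg_mul_min_expMeasure_one hk (abs_nonneg c)]
    refine integral_congr_ae ?_
    filter_upwards [ae_expMeasure_one_pos] with z hz
    rw [abs_of_nonneg (le_min hz.le (abs_nonneg _))]
  rw [integral_congr_ae hae, integral_columnLaw (integrable_exp_neg_mul_abs (by fun_prop) hk)]
  simp only [hz]
  have hi : Integrable (fun p : ℝ × ℝ => Real.exp (-(((k : ℝ) + 1 + 1) * |t.2 - t.1 + p.2 - p.1|)))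
      ((expMeasure 1).prod (expMeasure 1)) := integrable_exp_neg_mul_abs (by fun_prop) (by positivity)
  have hy : ∀ x : ℝ, Integrable
      (fun y : ℝ => Real.exp (-(((k : ℝ) + 1 + 1) * |t.2 - t.1 + y - x|))) (expMeasure 1) :=
    fun x => integrable_exp_neg_mul_abs (by fun_prop) (by positivity)
  have hxy := hi.integral_prod_left
  simp only [integral_add (integrable_const _) ((hy _).const_mul _), integral_const_mul]
  rw [integral_add (integrable_const _) (hxy.const_mul _), integral_const_mul,
    integral_integral_exp_neg_mul_abs (by linarith [k.cast_nonneg (α := ℝ)])]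
  have h1 : (k : ℝ) + 1 ≠ 0 := by positivity
  have h2 : (k : ℝ) + 2 ≠ 0 := by positivity
  have h3 : (k : ℝ) + 3 ≠ 0 := by positivity
  rw [show (k : ℝ) + 1 + 1 = k + 2 by ring, show ((k : ℝ) + 2) ^ 2 - 1 = (k + 1) * (k + 3) by ring]
  simp only [integral_const, probReal_univ, one_smul]
  field_simp
  ring

theorem integral_ladderCorrector_ladderStep (t : ℝ × ℝ) :
    ∫ u, ladderCorrector ((ladderStep t u).2 - (ladderStep t u).1) ∂columnLaw =
      ladderCorrector (t.2 - t.1) + (ladderRate - 1) + Real.exp (-|t.2 - t.1|) / 2 := by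
  set d := t.2 - t.1
  have hm := measurable_ladderStep_left t
  have hF : ∀ k : ℕ, Integrable (fun u => correctorCoeff k *
      Real.exp (-((k + 1) * |(ladderStep t u).2 - (ladderStep t u).1|))) columnLaw := fun k =>
    (integrable_exp_neg_mul_abs (hm.snd.sub hm.fst) (by positivity)).const_mul _
  have hsum : Summable fun k : ℕ => ∫ u, ‖correctorCoeff k *
      Real.exp (-((k + 1) * |(ladderStep t u).2 - (ladderStep t u).1|))‖ ∂columnLaw := by
    refine Summable.of_nonneg_of_le (fun k => integral_nonneg fun u => norm_nonneg _) (fun k => ?_)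
      summable_correctorCoeff.abs
    refine (integral_mono (hF k).norm (integrable_const |correctorCoeff k|)
      fun u => norm_correctorCoeff_mul_exp_le k _).trans ?_
    simp
  have h := hasSum_integral_of_summable_integral_norm hF hsum
  refine h.unique ?_
  have hs := (hasSum_nat_add_iff' 1).2 (hasSum_ladderCorrector d)
  have := (hasSum_correctorCoeff_div_add_two.add
    (hasSum_correctorCoeff_div_add_three.mul_right (Real.exp (-|d|)))).add hs
  convert! this using 1
  · ext k
    rw [integral_const_mul, integral_exp_ladderStep, correctorCoeff_succ,
      show ((k + 1 : ℕ) : ℝ) + 1 = k + 2 by push_cast; ring]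
    ring
  · simp
    ring

/-- The amount by which the increment of the corrected passage time `min a b +
ladderCorrector (b - a)`, caused by a new column with weights `u`, exceeds `ladderRate`. -/
noncomputable def ladderIncrement (t : ℝ × ℝ) (u : ℝ × ℝ × ℝ) : ℝ :=
  min (ladderStep t u).1 (ladderStep t u).2 - min t.1 t.2 +
    (ladderCorrector ((ladderStep t u).2 - (ladderStep t u).1) - ladderCorrector (t.2 - t.1)) -
    ladderRate

theorem measurable_ladderIncrement :
    Measurable fun p : (ℝ × ℝ) × ℝ × ℝ × ℝ => ladderIncrement p.1 p.2 := by
  have := measurable_ladderStep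
  have hc := continuous_ladderCorrector.measurable
  unfold ladderIncrement
  fun_prop

/-- A square-integrable bound on `ladderIncrement`, uniform in the passage times. -/
noncomputable def incrementBound (u : ℝ × ℝ × ℝ) : ℝ :=
  |u.1| + |u.2.1| + |u.2.2| + (2 * ∑' k, |correctorCoeff k| + |ladderRate|)

theorem abs_ladderIncrement_le (t : ℝ × ℝ) (u : ℝ × ℝ × ℝ) :
    |ladderIncrement t u| ≤ incrementBound u := by
  have h1 := abs_ladderCorrector_le ((ladderStep t u).2 - (ladderStep t u).1)
  have h2 := abs_ladderCorrector_le (t.2 - t.1)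
  have h3 : |min (ladderStep t u).1 (ladderStep t u).2 - min t.1 t.2| ≤
      |u.1| + |u.2.1| + |u.2.2| := by
    rw [min_ladderStep]
    obtain ⟨a, b⟩ := t
    obtain ⟨x, y, z⟩ := u
    simp only
    clear h1 h2
    grind
  rw [ladderIncrement, incrementBound]
  have h4 := abs_sub (ladderCorrector ((ladderStep t u).2 - (ladderStep t u).1))
    (ladderCorrector (t.2 - t.1))
  refine (abs_sub _ _).trans ?_
  have h5 := abs_add_le (min (ladderStep t u).1 (ladderStep t u).2 - min t.1 t.2)
    (ladderCorrector ((ladderStep t u).2 - (ladderStep t u).1) - ladderCorrector (t.2 - t.1))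
  linarith

theorem memLp_two_incrementBound : MemLp incrementBound 2 columnLaw := by
  have h := memLp_two_id_expMeasure_one
  have hx : MemLp (fun u : ℝ × ℝ × ℝ => u.1) 2 columnLaw :=
    h.comp_measurePreserving measurePreserving_fst_columnLaw
  have hy : MemLp (fun u : ℝ × ℝ × ℝ => u.2.1) 2 columnLaw :=
    h.comp_measurePreserving measurePreserving_snd_fst_columnLaw
  have hz : MemLp (fun u : ℝ × ℝ × ℝ => u.2.2) 2 columnLaw :=
    h.comp_measurePreserving measurePreserving_snd_snd_columnLaw
  exact ((hx.abs.add hy.abs).add hz.abs).add (memLp_const _)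

theorem memLp_two_ladderIncrement (t : ℝ × ℝ) : MemLp (ladderIncrement t) 2 columnLaw :=
  memLp_two_incrementBound.mono
    (measurable_ladderIncrement.comp measurable_prodMk_left).aestronglyMeasurable
    (Eventually.of_forall fun u => (abs_ladderIncrement_le t u).trans (le_abs_self _))

/-- The Poisson equation of the ladder. -/
theorem integral_ladderIncrement (t : ℝ × ℝ) : ∫ u, ladderIncrement t u ∂columnLaw = 0 := by
  have hm := measurable_ladderStep_left t
  have hc : Integrable
      (fun u => ladderCorrector ((ladderStep t u).2 - (ladderStep t u).1)) columnLaw :=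
    Integrable.of_bound (C := ∑' k, |correctorCoeff k|)
      (continuous_ladderCorrector.measurable.comp (hm.snd.sub hm.fst)).aestronglyMeasurable
      (Eventually.of_forall fun u => abs_ladderCorrector_le _)
  have hmin : Integrable (fun u => min (ladderStep t u).1 (ladderStep t u).2) columnLaw := by
    have h := (memLp_two_ladderIncrement t).integrable (by norm_num)
    refine ((h.add (integrable_const
      (min t.1 t.2 + ladderCorrector (t.2 - t.1) + ladderRate))).sub hc).congr
      (Eventually.of_forall fun u => ?_)
    simp only [Pi.add_apply, Pi.sub_apply, ladderIncrement]
    ring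
  have h : ∀ u, ladderIncrement t u = min (ladderStep t u).1 (ladderStep t u).2 +
      ladderCorrector ((ladderStep t u).2 - (ladderStep t u).1) -
        (min t.1 t.2 + ladderCorrector (t.2 - t.1) + ladderRate) := fun u => by
    rw [ladderIncrement]; ring
  have hadd : Integrable (fun u => min (ladderStep t u).1 (ladderStep t u).2 +
      ladderCorrector ((ladderStep t u).2 - (ladderStep t u).1)) columnLaw := hmin.add hc
  simp only [h]
  rw [integral_sub hadd (integrable_const _), integral_add hmin hc,
    integral_min_ladderStep, integral_ladderCorrector_ladderStep]
  simp
  ring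

/-! ### The law of large numbers -/

theorem ae_tendsto_zero_of_summable_integral {α : Type*} [MeasurableSpace α] {μ : Measure α}
    {f : ℕ → α → ℝ} (hf : ∀ n, Integrable (f n) μ) (hf₀ : ∀ n x, 0 ≤ f n x)
    (hsum : Summable fun n => ∫ x, f n x ∂μ) :
    ∀ᵐ x ∂μ, Tendsto (fun n => f n x) atTop (𝓝 0) := by
  have hlt : ∫⁻ x, ∑' n, ENNReal.ofReal (f n x) ∂μ ≠ ⊤ := by
    rw [lintegral_tsum fun n => (hf n).aestronglyMeasurable.aemeasurable.ennreal_ofReal]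
    simp only [← ofReal_integral_eq_lintegral_ofReal (hf _) (Eventually.of_forall (hf₀ _))]
    exact hsum.tsum_ofReal_ne_top
  have hae := ae_lt_top' (AEMeasurable.tsum fun n =>
    (hf n).aestronglyMeasurable.aemeasurable.ennreal_ofReal) hlt
  filter_upwards [hae] with x hx
  have h := ENNReal.tendsto_toReal_zero_iff (fun n => ENNReal.ofReal_ne_top) |>.2
    (ENNReal.tendsto_atTop_zero_of_tsum_ne_top hx.ne)
  simpa [ENNReal.toReal_ofReal (hf₀ _ x)] using h

/-- The passage times along the ladder, corrected so as to form a martingale. -/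
noncomputable def ladderMartingale (n : ℕ) (t : ℝ × ℝ) : ℝ :=
  min t.1 t.2 + ladderCorrector (t.2 - t.1) - n * ladderRate

theorem ladderMartingale_succ (n : ℕ) (t : ℝ × ℝ) (u : ℝ × ℝ × ℝ) :
    ladderMartingale (n + 1) (ladderStep t u) = ladderMartingale n t + ladderIncrement t u := by
  simp only [ladderMartingale, ladderIncrement]
  push_cast
  ring

theorem measurable_ladderMartingale (n : ℕ) : Measurable (ladderMartingale n) := by
  have hc := continuous_ladderCorrector.measurable
  unfold ladderMartingale
  fun_prop

/-- The weights on which the passage times to column `n` depend: those of the horizontal edges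
before it and of the rungs up to and including it. -/
def ladderPast (n : ℕ) : Set (Fin 3 × ℕ) :=
  {p | p.2 < n ∨ p.2 = n ∧ p.1 = 2}

theorem measurable_ladderTimes_iSup {Ω : Type*} (W : Fin 3 × ℕ → Ω → ℝ) (n : ℕ) :
    Measurable[⨆ p ∈ ladderPast n, MeasurableSpace.comap (W p) inferInstance] fun ω =>
      ladderTimes (fun i => W (0, i) ω) (fun i => W (1, i) ω) (fun i => W (2, i) ω) n := by
  have hle : ∀ {n : ℕ} {p : Fin 3 × ℕ}, p ∈ ladderPast n →
      Measurable[⨆ p ∈ ladderPast n, MeasurableSpace.comap (W p) inferInstance] (W p) :=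
    fun {n p} hp => measurable_iff_comap_le.2
      (le_iSup₂ (f := fun p (_ : p ∈ ladderPast n) => MeasurableSpace.comap (W p) inferInstance)
        p hp)
  induction n with
  | zero => exact measurable_const.prodMk (hle (Or.inr ⟨rfl, rfl⟩))
  | succ n ih =>
    have hmono : (⨆ p ∈ ladderPast n, MeasurableSpace.comap (W p) inferInstance) ≤
        ⨆ p ∈ ladderPast (n + 1), MeasurableSpace.comap (W p) inferInstance :=
      biSup_mono fun p hp => Or.inl (by rcases hp with h | h <;> omega)
    refine measurable_ladderStep.comp ((ih.mono hmono le_rfl).prodMk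
      ((hle ?_).prodMk ((hle ?_).prodMk (hle ?_))))
    · exact Or.inl (Nat.lt_succ_self n)
    · exact Or.inl (Nat.lt_succ_self n)
    · exact Or.inr ⟨rfl, rfl⟩

section Probability

variable {Ω : Type*} [MeasurableSpace Ω] {P : Measure Ω}

/-- The increments of `ladderMartingale` are orthogonal to its past, so that second moments add
up. -/
theorem integral_sq_ladderMartingale_succ_le [IsProbabilityMeasure P] {T : Ω → ℝ × ℝ} {U : Ω → ℝ × ℝ × ℝ}
    (hT : Measurable T) (hU : Measurable U) (hlaw : HasLaw U columnLaw P) (hTU : IndepFun T U P)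
    {n : ℕ} (hN : MemLp (fun ω => ladderMartingale n (T ω)) 2 P) :
    MemLp (fun ω => ladderMartingale (n + 1) (ladderStep (T ω) (U ω))) 2 P ∧
      ∫ ω, ladderMartingale (n + 1) (ladderStep (T ω) (U ω)) ^ 2 ∂P ≤
        ∫ ω, ladderMartingale n (T ω) ^ 2 ∂P + ∫ u, incrementBound u ^ 2 ∂columnLaw := by
  have hmp := hlaw.measurePreserving hU
  have hmeas : Measurable fun ω => ladderIncrement (T ω) (U ω) :=
    measurable_ladderIncrement.comp (hT.prodMk hU)
  have hB : MemLp (fun ω => incrementBound (U ω)) 2 P :=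
    memLp_two_incrementBound.comp_measurePreserving hmp
  have hle : ∀ ω, |ladderIncrement (T ω) (U ω)| ≤ |incrementBound (U ω)| := fun ω =>
    (abs_ladderIncrement_le _ _).trans (le_abs_self _)
  have hI : MemLp (fun ω => ladderIncrement (T ω) (U ω)) 2 P :=
    hB.mono hmeas.aestronglyMeasurable (Eventually.of_forall hle)
  have hcross : Integrable
      (fun ω => ladderMartingale n (T ω) * ladderIncrement (T ω) (U ω)) P := hN.integrable_mul hI
  have hF : Measurable fun p : (ℝ × ℝ) × ℝ × ℝ × ℝ =>
      ladderMartingale n p.1 * ladderIncrement p.1 p.2 :=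
    ((measurable_ladderMartingale n).comp measurable_fst).mul measurable_ladderIncrement
  have hmap : P.map (fun ω => (T ω, U ω)) = (P.map T).prod columnLaw := by
    rw [← hlaw.map_eq]
    exact (indepFun_iff_map_prod_eq_prod_map_map hT.aemeasurable hU.aemeasurable).1 hTU
  have : IsProbabilityMeasure (P.map T) := Measure.isProbabilityMeasure_map hT.aemeasurable
  have hzero : ∫ ω, ladderMartingale n (T ω) * ladderIncrement (T ω) (U ω) ∂P = 0 := by
    have hint : Integrable (fun p : (ℝ × ℝ) × ℝ × ℝ × ℝ =>
        ladderMartingale n p.1 * ladderIncrement p.1 p.2) ((P.map T).prod columnLaw) := by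
      rw [← hmap]
      exact (integrable_map_measure hF.aestronglyMeasurable (hT.prodMk hU).aemeasurable).2 hcross
    have h := integral_map (μ := P) (hT.prodMk hU).aemeasurable
      (f := fun p => ladderMartingale n p.1 * ladderIncrement p.1 p.2) hF.aestronglyMeasurable
    rw [← h, hmap, integral_prod _ hint]
    simp [integral_const_mul, integral_ladderIncrement]
  simp only [ladderMartingale_succ]
  refine ⟨hN.add hI, ?_⟩
  have hsq : ∀ ω, (ladderMartingale n (T ω) + ladderIncrement (T ω) (U ω)) ^ 2 =
      ladderMartingale n (T ω) ^ 2 +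
        2 * (ladderMartingale n (T ω) * ladderIncrement (T ω) (U ω)) +
        ladderIncrement (T ω) (U ω) ^ 2 := fun ω => by ring
  have h12 : Integrable (fun ω => ladderMartingale n (T ω) ^ 2 +
      2 * (ladderMartingale n (T ω) * ladderIncrement (T ω) (U ω))) P :=
    hN.integrable_sq.add (hcross.const_mul 2)
  simp only [hsq]
  rw [integral_add h12 hI.integrable_sq, integral_add hN.integrable_sq (hcross.const_mul 2),
    integral_const_mul, hzero, mul_zero, add_zero]
  gcongr
  rw [← hlaw.integral_comp memLp_two_incrementBound.integrable_sq.aestronglyMeasurable]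
  exact integral_mono hI.integrable_sq hB.integrable_sq fun ω => sq_le_sq.2 (hle ω)

variable {W : Fin 3 × ℕ → Ω → ℝ}

theorem measurable_ladderTimes (hW : ∀ p, Measurable (W p)) (n : ℕ) :
    Measurable fun ω =>
      ladderTimes (fun i => W (0, i) ω) (fun i => W (1, i) ω) (fun i => W (2, i) ω) n :=
  (measurable_ladderTimes_iSup W n).mono (iSup₂_le fun p _ => (hW p).comap_le) le_rfl

theorem indepFun_ladderTimes (hW : ∀ p, Measurable (W p)) (hind : iIndepFun W P) (n : ℕ) :
    IndepFun
      (fun ω => ladderTimes (fun i => W (0, i) ω) (fun i => W (1, i) ω) (fun i => W (2, i) ω) n)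
      (fun ω => (W (0, n) ω, W (1, n) ω, W (2, n + 1) ω)) P := by
  rw [IndepFun_iff_Indep]
  have hdisj : Disjoint (ladderPast n) {(0, n), (1, n), (2, n + 1)} := by
    rw [Set.disjoint_right]
    rintro p (rfl | rfl | rfl) <;> simp [ladderPast]
  have hI := indep_iSup_of_disjoint (fun p => (hW p).comap_le) hind.iIndep hdisj
  refine indep_of_indep_of_le_left (indep_of_indep_of_le_right hI ?_)
    (measurable_ladderTimes_iSup W n).comap_le
  have hle : ∀ p ∈ ({(0, n), (1, n), (2, n + 1)} : Set (Fin 3 × ℕ)),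
      Measurable[⨆ p ∈ ({(0, n), (1, n), (2, n + 1)} : Set (Fin 3 × ℕ)),
        MeasurableSpace.comap (W p) inferInstance] (W p) :=
    fun p hp => measurable_iff_comap_le.2
      (le_iSup₂ (f := fun p (_ : p ∈ ({(0, n), (1, n), (2, n + 1)} : Set (Fin 3 × ℕ))) =>
        MeasurableSpace.comap (W p) inferInstance) p hp)
  exact ((hle (0, n) (by simp)).prodMk
    ((hle (1, n) (by simp)).prodMk (hle (2, n + 1) (by simp)))).comap_le

theorem hasLaw_column [IsProbabilityMeasure P] (hW : ∀ p, Measurable (W p)) (hlaw : ∀ p, HasLaw (W p) (expMeasure 1) P)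
    (hind : iIndepFun W P) (n : ℕ) :
    HasLaw (fun ω => (W (0, n) ω, W (1, n) ω, W (2, n + 1) ω)) columnLaw P := by
  have h12 : IndepFun (W (1, n)) (W (2, n + 1)) P := hind.indepFun (by simp)
  have h0 : IndepFun (W (0, n)) (fun ω => (W (1, n) ω, W (2, n + 1) ω)) P :=
    (hind.indepFun_prodMk hW (1, n) (2, n + 1) (0, n) (by simp) (by simp)).symm
  exact h0.hasLaw_prod (hlaw _) (h12.hasLaw_prod (hlaw _) (hlaw _))

theorem exists_integral_sq_ladderMartingale_le [IsProbabilityMeasure P] (hW : ∀ p, Measurable (W p))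
    (hlaw : ∀ p, HasLaw (W p) (expMeasure 1) P) (hind : iIndepFun W P) :
    ∃ C, ∀ n, MemLp (fun ω => ladderMartingale n (ladderTimes (fun i => W (0, i) ω)
        (fun i => W (1, i) ω) (fun i => W (2, i) ω) n)) 2 P ∧
      ∫ ω, ladderMartingale n (ladderTimes (fun i => W (0, i) ω)
        (fun i => W (1, i) ω) (fun i => W (2, i) ω) n) ^ 2 ∂P ≤ C * (n + 1) := by
  set T : ℕ → Ω → ℝ × ℝ := fun n ω => ladderTimes (fun i => W (0, i) ω)
    (fun i => W (1, i) ω) (fun i => W (2, i) ω) n with hTdef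
  set U : ℕ → Ω → ℝ × ℝ × ℝ := fun n ω => (W (0, n) ω, W (1, n) ω, W (2, n + 1) ω)
  have hT := measurable_ladderTimes hW
  have h0 : MemLp (fun ω => ladderMartingale 0 (T 0 ω)) 2 P := by
    have hZ : MemLp (W (2, 0)) 2 P :=
      memLp_two_id_expMeasure_one.comp_measurePreserving ((hlaw (2, 0)).measurePreserving (hW _))
    have hB : MemLp (fun ω => |W (2, 0) ω| + ∑' k, |correctorCoeff k|) 2 P :=
      hZ.abs.add (memLp_const _)
    refine hB.mono ((measurable_ladderMartingale 0).comp (hT 0)).aestronglyMeasurable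
      (Eventually.of_forall fun ω => ?_)
    rw [Real.norm_eq_abs, Real.norm_eq_abs]
    refine le_trans ?_ (le_abs_self _)
    simp only [hTdef, ladderTimes, ladderMartingale, Nat.cast_zero, zero_mul, sub_zero]
    refine (abs_add_le _ _).trans (add_le_add ?_ (abs_ladderCorrector_le _))
    grind
  set A := ∫ ω, ladderMartingale 0 (T 0 ω) ^ 2 ∂P
  set B := ∫ u, incrementBound u ^ 2 ∂columnLaw
  have hA : 0 ≤ A := integral_nonneg fun ω => sq_nonneg _
  have hB : 0 ≤ B := integral_nonneg fun ω => sq_nonneg _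
  have key : ∀ n : ℕ, MemLp (fun ω => ladderMartingale n (T n ω)) 2 P ∧
      ∫ ω, ladderMartingale n (T n ω) ^ 2 ∂P ≤ A + n * B := by
    intro n
    induction n with
    | zero => exact ⟨h0, by simp [A]⟩
    | succ n ih =>
      have h := integral_sq_ladderMartingale_succ_le (U := U n) (hT n)
        ((hW _).prodMk ((hW _).prodMk (hW _))) (hasLaw_column hW hlaw hind n)
        (indepFun_ladderTimes hW hind n) ih.1
      refine ⟨h.1, h.2.trans ?_⟩
      push_cast
      linarith [ih.2]
  refine ⟨A + B, fun n => ⟨(key n).1, (key n).2.trans ?_⟩⟩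
  nlinarith [n.cast_nonneg (α := ℝ)]

theorem ae_tendsto_ladderMartingale_div [IsProbabilityMeasure P] (hW : ∀ p, Measurable (W p))
    (hlaw : ∀ p, HasLaw (W p) (expMeasure 1) P) (hind : iIndepFun W P) :
    ∀ᵐ ω ∂P, Tendsto (fun k : ℕ => ladderMartingale ((k + 1) ^ 2) (ladderTimes
      (fun i => W (0, i) ω) (fun i => W (1, i) ω) (fun i => W (2, i) ω) ((k + 1) ^ 2)) /
        (((k + 1) ^ 2 : ℕ) : ℝ)) atTop (𝓝 0) := by
  obtain ⟨C, hC⟩ := exists_integral_sq_ladderMartingale_le hW hlaw hind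
  have hs : Summable fun k : ℕ => 2 * C * (1 / ((k + 1 : ℕ) : ℝ) ^ 2) :=
    ((summable_nat_add_iff 1).2 (Real.summable_one_div_nat_pow.2 one_lt_two)).mul_left _
  have h := ae_tendsto_zero_of_summable_integral (μ := P)
    (f := fun k ω => (ladderMartingale ((k + 1) ^ 2) (ladderTimes
      (fun i => W (0, i) ω) (fun i => W (1, i) ω) (fun i => W (2, i) ω) ((k + 1) ^ 2)) /
        (((k + 1) ^ 2 : ℕ) : ℝ)) ^ 2)
    (fun k => by simpa only [div_pow] using (hC ((k + 1) ^ 2)).1.integrable_sq.div_const _)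
    (fun k ω => sq_nonneg _) ?_
  · filter_upwards [h] with ω hω
    exact (tendsto_zero_iff_abs_tendsto_zero _).2
      (by simpa [Real.sqrt_sq_eq_abs, Function.comp_def] using hω.sqrt)
  · refine Summable.of_nonneg_of_le (fun k => integral_nonneg fun ω => sq_nonneg _) (fun k => ?_) hs
    simp only [div_pow]
    rw [integral_div, div_le_iff₀ (by positivity)]
    refine (hC ((k + 1) ^ 2)).2.trans ?_
    have hC0 : 0 ≤ C := by
      have := (integral_nonneg fun ω => sq_nonneg _).trans (hC 0).2
      simpa using this
    have hk : (1 : ℝ) ≤ ((k + 1 : ℕ) : ℝ) ^ 2 := one_le_pow₀ (by simp)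
    have hk0 : ((k + 1 : ℕ) : ℝ) ≠ 0 := by positivity
    push_cast at hk hk0 ⊢
    field_simp
    nlinarith

theorem ae_tendsto_div_nat_of_hasLaw_expMeasure_one {Z : ℕ → Ω → ℝ} (hZ : ∀ n, Measurable (Z n))
    (hlaw : ∀ n, HasLaw (Z n) (expMeasure 1) P) :
    ∀ᵐ ω ∂P, Tendsto (fun n : ℕ => Z n ω / n) atTop (𝓝 0) := by
  have h2 : ∀ n, MemLp (Z n) 2 P := fun n =>
    memLp_two_id_expMeasure_one.comp_measurePreserving ((hlaw n).measurePreserving (hZ n))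
  have hs : Summable fun n : ℕ => (∫ x, x ^ 2 ∂expMeasure 1) * (1 / (n : ℝ) ^ 2) :=
    (Real.summable_one_div_nat_pow.2 one_lt_two).mul_left _
  have h := ae_tendsto_zero_of_summable_integral (μ := P) (f := fun n ω => (Z n ω / n) ^ 2)
    (fun n => by simpa only [div_pow] using (h2 n).integrable_sq.div_const _)
    (fun n ω => sq_nonneg _) (hs.congr fun n => by
      simp only [div_pow]
      have := (hlaw n).integral_comp (f := fun x => x ^ 2) (by fun_prop)
      simp only [Function.comp_def] at this
      rw [integral_div, this]
      ring)
  filter_upwards [h] with ω hω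
  exact (tendsto_zero_iff_abs_tendsto_zero _).2
    (by simpa [Real.sqrt_sq_eq_abs, Function.comp_def] using hω.sqrt)

theorem eventually_sq_succ_le_mul_sq {a : ℝ} (ha : 1 < a) :
    ∀ᶠ k : ℕ in atTop, (((k + 1 + 1) ^ 2 : ℕ) : ℝ) ≤ a * (((k + 1) ^ 2 : ℕ) : ℝ) := by
  filter_upwards [eventually_ge_atTop ⌈3 / (a - 1)⌉₊] with k hk
  have hk' : 3 / (a - 1) ≤ k := Nat.ceil_le.1 hk
  rw [div_le_iff₀ (by linarith)] at hk'
  push_cast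
  nlinarith [k.cast_nonneg (α := ℝ)]

/-- The time constant for a deterministic environment in which the corrected passage times are
asymptotically negligible along the squares. The smaller of the two passage times is monotone in
the column, which fills the gaps between the squares. -/
theorem tendsto_ladderTimes_div {X Y Z : ℕ → ℝ} (hX : ∀ n, 0 ≤ X n) (hY : ∀ n, 0 ≤ Y n)
    (hZ : ∀ n, 0 ≤ Z n)
    (hN : Tendsto (fun k : ℕ => ladderMartingale ((k + 1) ^ 2) (ladderTimes X Y Z ((k + 1) ^ 2)) /
      (((k + 1) ^ 2 : ℕ) : ℝ)) atTop (𝓝 0))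
    (hZlim : Tendsto (fun n : ℕ => Z n / n) atTop (𝓝 0)) :
    Tendsto (fun n : ℕ => (ladderTimes X Y Z n).1 / n) atTop (𝓝 ladderRate) := by
  have hmono : Monotone fun n => min (ladderTimes X Y Z n).1 (ladderTimes X Y Z n).2 := by
    refine monotone_nat_of_le_succ fun n => ?_
    rw [ladderTimes, min_ladderStep, min_eq_left (hZ (n + 1)), add_zero]
    exact min_le_min (le_add_of_nonneg_right (hX n)) (le_add_of_nonneg_right (hY n))
  have hc : Tendsto (fun k : ℕ => (k + 1) ^ 2) atTop atTop :=
    (tendsto_pow_atTop two_ne_zero).comp (tendsto_add_atTop_nat 1)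
  have hcorr : Tendsto (fun k : ℕ => ladderCorrector ((ladderTimes X Y Z ((k + 1) ^ 2)).2 -
      (ladderTimes X Y Z ((k + 1) ^ 2)).1) / (((k + 1) ^ 2 : ℕ) : ℝ)) atTop (𝓝 0) := by
    refine squeeze_zero_norm (fun k => ?_) ((tendsto_const_nhds
      (x := ∑' k, |correctorCoeff k|)).div_atTop (tendsto_natCast_atTop_atTop.comp hc))
    rw [norm_div, Real.norm_natCast, Function.comp_apply]
    exact div_le_div_of_nonneg_right (abs_ladderCorrector_le _) (Nat.cast_nonneg _)
  have hmin : Tendsto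
      (fun n : ℕ => min (ladderTimes X Y Z n).1 (ladderTimes X Y Z n).2 / (n : ℝ)) atTop
      (𝓝 ladderRate) := by
    refine tendsto_div_of_monotone_of_exists_subseq_tendsto_div _ _ hmono fun a ha =>
      ⟨fun k => (k + 1) ^ 2, eventually_sq_succ_le_mul_sq ha, hc, ?_⟩
    have h := (hN.sub hcorr).add_const ladderRate
    rw [sub_zero, zero_add] at h
    refine h.congr fun k => ?_
    have : (((k + 1) ^ 2 : ℕ) : ℝ) ≠ 0 := by positivity
    rw [ladderMartingale]
    field_simp
    ring
  have hup := hmin.add hZlim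
  rw [add_zero] at hup
  refine tendsto_of_tendsto_of_tendsto_of_le_of_le hmin hup (fun n => ?_) fun n => ?_
  · exact div_le_div_of_nonneg_right (min_le_left _ _) (Nat.cast_nonneg _)
  · change _ ≤ _ / _ + _ / _
    rw [← add_div]
    refine div_le_div_of_nonneg_right ?_ (Nat.cast_nonneg _)
    have h := abs_le.1 (abs_ladderTimes_sub_le (X := X) (Y := Y) hZ n)
    rcases min_choice (ladderTimes X Y Z n).1 (ladderTimes X Y Z n).2 with h' | h' <;> rw [h'] <;>
      linarith [h.1, hZ n]

end Probability

/-! ### The time constant of the ladder -/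

/-- The edges of the ladder: for `j = 0, 1, 2`, the pair `(j, i)` is sent to the horizontal edge to
the right of column `i` in row `0`, the one in row `1`, and the rung in column `i`. -/
def ladderEdge (p : Fin 3 × ℕ) : Sym2 (ℕ × Fin 2) :=
  ![s((p.2, 0), (p.2 + 1, 0)), s((p.2, 1), (p.2 + 1, 1)), s((p.2, 0), (p.2, 1))] p.1

theorem ladderEdge_injective : Function.Injective ladderEdge := by
  rintro ⟨j, m⟩ ⟨k, n⟩ h
  fin_cases j <;> fin_cases k <;> simp [ladderEdge] at h ⊢ <;> omega

theorem range_ladderEdge : Set.range ladderEdge = stretchEdges {.X, .Y, .Z} := by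
  ext e
  simp only [stretchEdges, Set.mem_iUnion, mem_edgeSet_stretch_ladder, Set.mem_range]
  constructor
  · rintro ⟨⟨j, i⟩, rfl⟩
    refine ⟨i + 1, ?_⟩
    fin_cases j
    · exact Or.inl ⟨i, by omega, rfl⟩
    · exact Or.inr (Or.inl ⟨i, by omega, rfl⟩)
    · exact Or.inr (Or.inr ⟨i, by omega, rfl⟩)
  · rintro ⟨n, ⟨i, -, rfl⟩ | ⟨i, -, rfl⟩ | ⟨i, -, rfl⟩⟩
    · exact ⟨(0, i), rfl⟩
    · exact ⟨(1, i), rfl⟩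
    · exact ⟨(2, i), rfl⟩

theorem mainTheorem1 {Ω : Type*} [MeasurableSpace Ω] (P : Measure Ω) [IsProbabilityMeasure P]
    (w : Sym2 (ℕ × Fin 2) → Ω → ℝ)
    (hlaw : ∀ e ∈ stretchEdges {.X, .Y, .Z}, HasLaw (w e) (expMeasure 1) P)
    (hindep : iIndepFun (fun e : stretchEdges {.X, .Y, .Z} => w e) P) :
    IsPercolationRate P {.X, .Y, .Z} w (3 / 2 - besselJ 1 2 / (2 * besselJ 2 2)) ∧
      3 / 2 - besselJ 1 2 / (2 * besselJ 2 2) ∈ Set.Ico (0.68 : ℝ) 0.69 := by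
  refine ⟨?_, ladderRate_mem_Ico⟩
  have hmem : ∀ p, ladderEdge p ∈ stretchEdges {.X, .Y, .Z} := fun p =>
    range_ladderEdge ▸ Set.mem_range_self p
  -- The weights are only almost everywhere measurable, so they are replaced by measurable versions.
  have hae : ∀ p, AEMeasurable (w (ladderEdge p)) P := fun p => (hlaw _ (hmem p)).aemeasurable
  set W : Fin 3 × ℕ → Ω → ℝ := fun p => (hae p).mk
  have hWw : ∀ p, w (ladderEdge p) =ᵐ[P] W p := fun p => (hae p).ae_eq_mk
  have hW : ∀ p, Measurable (W p) := fun p => (hae p).measurable_mk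
  have hWlaw : ∀ p, HasLaw (W p) (expMeasure 1) P := fun p =>
    (hlaw _ (hmem p)).congr (hWw p).symm
  have hind : iIndepFun W P := by
    have h := hindep.precomp (g := fun p : Fin 3 × ℕ =>
      (⟨ladderEdge p, hmem p⟩ : stretchEdges {.X, .Y, .Z})) fun p q hpq =>
        ladderEdge_injective (congrArg Subtype.val hpq)
    exact h.congr hWw
  have hpos : ∀ᵐ ω ∂P, ∀ p, 0 ≤ W p ω := ae_all_iff.2 fun p =>
    (((hWlaw p).measurePreserving (hW p)).quasiMeasurePreserving.ae
      ae_expMeasure_one_pos).mono fun _ => le_of_lt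
  filter_upwards [hpos, ae_all_iff.2 hWw, ae_tendsto_ladderMartingale_div hW hWlaw hind,
    ae_tendsto_div_nat_of_hasLaw_expMeasure_one (fun n => hW (2, n)) (fun n => hWlaw (2, n))]
    with ω h0 hω hN hZ
  have hw0 : ∀ e ∈ stretchEdges {.X, .Y, .Z}, 0 ≤ w e ω := by
    rw [← range_ladderEdge]
    rintro _ ⟨p, rfl⟩
    exact (h0 p).trans_eq (hω p).symm
  simp only [firstPassageTime_ladder hw0]
  have hx : (fun i : ℕ => w s((i, 0), (i + 1, 0)) ω) = fun i => W (0, i) ω :=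
    funext fun i => hω (0, i)
  have hy : (fun i : ℕ => w s((i, 1), (i + 1, 1)) ω) = fun i => W (1, i) ω :=
    funext fun i => hω (1, i)
  have hz : (fun i : ℕ => w s((i, 0), (i, 1)) ω) = fun i => W (2, i) ω :=
    funext fun i => hω (2, i)
  rw [hx, hy, hz]
  exact tendsto_ladderTimes_div (fun n => h0 _) (fun n => h0 _) (fun n => h0 _) hN hZ
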